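/- Let $f_1,\dots,f_N:\mathbb R^n\to\mathbb R^n$ be contracting similarities with ratios $\rho_1,\dots,\rho_N\in(0,1)$, i.e. $|f_i(x)-f_i(y)|=\rho_i|x-y|$ for all $x,y$, and suppose that they satisfy the open set condition: there is a non-empty open set $V\subseteq\mathbb R^n$ such that the sets $f_i(V)$ are pairwise disjoint and contained in $V$. Let $E\subset\mathbb R^n$ be a sub-self-similar set for $f_1,\dots,f_N$, i.e. a non-empty compact set with $E\subseteq\bigcup_{i=1}^N f_i(E)$, and let $S\subseteq\{1,\dots,N\}^{\mathbb N}$ be a compact set that is closed under the left shift and codes $E$: $$E=\Theta(S),\qquad \Theta(\omega)=\lim_{k\to\infty}f_{\omega_1}\circ\cdots\circ f_{\omega_k}(x)\quad(\text{for any }x\in\mathbb R^n).$$ For $k\ge 1$ let $S^k=\{\omega_1\cdots\omega_k:\omega\in S\}$, let $S^*=\bigcup_{k\ge1}S^k$, and for a word $w=w_1\cdots w_k$ put $f_w=f_{w_1}\circ\cdots\circ f_{w_k}$ and $\rho_w=\rho_{w_1}\cdots\rho_{w_k}$. Let $C\subset\mathbb R^n$ be compact and $$O_S=\bigcup_{w\in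 S^*}f_w(C).$$ Then there is a unique number $s\ge0$ such that $$\lim_{k\to\infty}\Big(\sum_{w\in S^k}\rho_w^{\,s}\Big)^{1/k}=1,$$ and for this $s$ $$\dim_H(E\cup O_S)=\max\{s,\dim_H C\}.$$ The same equality holds if the empty word is also admitted in $S^*$, i.e. if $O_S$ is replaced by $C\cup O_S$. (If $C=\emptyset$, then $\dim_H C=0$ by convention.) -/

import Mathlib

open Filter Topology MeasureTheory

/-- `g` is a contracting similarity with ratio `r`. -/
def IsContractingSimilarity {X : Type*} [MetricSpace X] (g : X → X) (r : ℝ) : Prop :=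
  0 < r ∧ r < 1 ∧ ∀ x y : X, dist (g x) (g y) = r * dist x y

/-- `E` is a sub-self-similar set for the family `f`: a non-empty compact set contained in
the union of its images. -/
def IsSubSelfSimilar {X : Type*} [MetricSpace X] {N : ℕ} (f : Fin N → X → X) (E : Set X) : Prop :=
  E.Nonempty ∧ IsCompact E ∧ E ⊆ ⋃ i, f i '' E

/-- The open set condition: some non-empty open `V` contains the sets `f i '' V`, and these
are pairwise disjoint. (For contracting maps, requiring `V` to be bounded as well gives an
equivalent condition.) -/
def OpenSetCondition {X : Type*} [MetricSpace X] {N : ℕ} (f : Fin N → X → X) : Prop :=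
  ∃ V : Set X, IsOpen V ∧ V.Nonempty ∧ (∀ i, f i '' V ⊆ V) ∧
    ∀ i j, i ≠ j → Disjoint (f i '' V) (f j '' V)

/-- A set of infinite sequences is closed under the left shift. -/
def ShiftClosed {N : ℕ} (S : Set (ℕ → Fin N)) : Prop :=
  ∀ ω ∈ S, (fun k => ω (k + 1)) ∈ S

/-- The initial word of length `k` of an infinite sequence. -/
def initialWord {N : ℕ} (k : ℕ) (ω : ℕ → Fin N) : Fin k → Fin N := fun j => ω j

/-- The set of initial words of length `k` of the sequences in `S`. -/
def initialWords {N : ℕ} (S : Set (ℕ → Fin N)) (k : ℕ) : Set (Fin k → Fin N) :=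
  initialWord k '' S

/-- The composition `f_{w₁} ∘ f_{w₂} ∘ ⋯ ∘ f_{w_k}` along a word `w` of length `k`. -/
def wordMap {X : Type*} {N : ℕ} (f : Fin N → X → X) : (k : ℕ) → (Fin k → Fin N) → X → X
  | 0, _ => id
  | k + 1, w => f (w 0) ∘ wordMap f k (Fin.tail w)

/-- The image `Θ(S)` of `S` under the coding map: the set of all points
`lim_{k → ∞} f_{ω₁} ∘ ⋯ ∘ f_{ω_k} (x)` with `ω ∈ S` (the limit being the same for all `x`). -/
def codedSet {X : Type*} [MetricSpace X] {N : ℕ} (f : Fin N → X → X)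
    (S : Set (ℕ → Fin N)) : Set X :=
  {y | ∃ ω ∈ S, ∀ x : X, Tendsto (fun k => wordMap f k (initialWord k ω) x) atTop (𝓝 y)}

/-- The set `O_S`: the union of `f_w(C)` over all words `w` of length at least one that are
initial words of sequences in `S`. -/
def orbitalSet {X : Type*} {N : ℕ} (f : Fin N → X → X) (S : Set (ℕ → Fin N))
    (C : Set X) : Set X :=
  ⋃ k : ℕ, ⋃ _ : 1 ≤ k, ⋃ w ∈ initialWords S k, wordMap f k w '' C

/-- The sum of `(ρ_{w₁} ⋯ ρ_{w_k}) ^ t` over the initial words `w` of length `k` of the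
sequences in `S`. -/
noncomputable def ratioSum {N : ℕ} (ρ : Fin N → ℝ) (S : Set (ℕ → Fin N)) (t : ℝ) (k : ℕ) : ℝ :=
  ∑ w ∈ (Set.toFinite (initialWords S k)).toFinset, (∏ j, ρ (w j)) ^ t

/-- `τ(t) = 1`: the limit of the `k`-th roots of the sums `ratioSum ρ S t k` exists and
equals `1`. -/
def TauEqOne {N : ℕ} (ρ : Fin N → ℝ) (S : Set (ℕ → Fin N)) (t : ℝ) : Prop :=
  Tendsto (fun k : ℕ => ratioSum ρ S t k ^ (1 / (k : ℝ))) atTop (𝓝 1)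

/-! Similarities preserve Hausdorff dimension and the dimension of a countable union is the
supremum, so `orbitalSet f S C` has the dimension of `C`. It remains to show that the coded set `E`
has dimension `s`.

Shift invariance makes the sums over words of length `k` submultiplicative, so their growth rate
exists. As a function of the exponent it is continuous, strictly decreasing, nonnegative at `0` and
eventually at most `0`; its unique zero is `s` (`existsUnique_tauEqOne`).

Upper bound (`dimH_codedSet_le`): the pieces `f_w(E)` with `w` of length `k` cover `E`, and for `t >
s` their `t`-sums tend to `0`.

Lower bound (`le_dimH_codedSet`): if `dimH E < t < s`, then `E` has finite ball covers with
arbitrarily small `t`-sum. By the open set condition each ball meets boundedly many pieces of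
comparable size (`exists_card_stopping_le`). Their words form a finite set `W` with `∑ ρ_w ^ t ≤ 1`
containing a prefix of every sequence in `S`. Cutting long words into blocks from `W` bounds the
sums at exponent `t` (`ratioSum_bounded`), yet below `s` they grow exponentially. No measure on `E`
is constructed. -/

/-! ### Words -/

/-- The list of the first `k` terms of a sequence. -/
def seqPrefix {α : Type*} : ℕ → (ℕ → α) → List α
  | 0, _ => []
  | k + 1, ω => ω 0 :: seqPrefix k (fun j => ω (j + 1))

/-- The product of the ratios along a word. -/
def wordRatio {α : Type*} (ρ : α → ℝ) (l : List α) : ℝ := (l.map ρ).prod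

/-- The composition of the maps along a word. -/
def listMap {α X : Type*} (f : α → X → X) : List α → X → X
  | [] => id
  | i :: l => f i ∘ listMap f l

theorem seqPrefix_length {α : Type*} (k : ℕ) (ω : ℕ → α) : (seqPrefix k ω).length = k := by
  induction k generalizing ω with
  | zero => rfl
  | succ k ih => simp [seqPrefix, ih]

theorem seqPrefix_add {α : Type*} (k m : ℕ) (ω : ℕ → α) :
    seqPrefix (k + m) ω = seqPrefix k ω ++ seqPrefix m (fun j => ω (j + k)) := by
  induction k generalizing ω with
  | zero => simp [seqPrefix]
  | succ k ih =>
    rw [Nat.add_right_comm, seqPrefix, ih]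
    simp [seqPrefix, Nat.add_assoc]

theorem seqPrefix_succ {α : Type*} (k : ℕ) (ω : ℕ → α) :
    seqPrefix (k + 1) ω = seqPrefix k ω ++ [ω k] := by
  rw [seqPrefix_add]; simp [seqPrefix]

theorem seqPrefix_eq_ofFn {N : ℕ} (k : ℕ) (ω : ℕ → Fin N) :
    seqPrefix k ω = List.ofFn (initialWord k ω) := by
  induction k generalizing ω with
  | zero => rfl
  | succ k ih => rw [seqPrefix, ih, List.ofFn_succ]; rfl

theorem eq_seqPrefix_of_isPrefix {α : Type*} {k : ℕ} {ω : ℕ → α} {v : List α}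
    (h : v <+: seqPrefix k ω) : v = seqPrefix v.length ω := by
  have hl : v.length ≤ k := by simpa [seqPrefix_length] using h.length_le
  obtain ⟨m, rfl⟩ := Nat.exists_eq_add_of_le hl
  rw [seqPrefix_add] at h
  exact (List.prefix_of_prefix_length_le h (List.prefix_append _ _)
    (by simp [seqPrefix_length])).eq_of_length (by simp [seqPrefix_length])

theorem wordMap_eq_listMap {X : Type*} {N : ℕ} (f : Fin N → X → X) (k : ℕ) (w : Fin k → Fin N) :
    wordMap f k w = listMap f (List.ofFn w) := by
  induction k with
  | zero => rfl
  | succ k ih => rw [wordMap, ih, List.ofFn_succ]; rfl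

theorem wordMap_initialWord {X : Type*} {N : ℕ} (f : Fin N → X → X) (k : ℕ) (ω : ℕ → Fin N) :
    wordMap f k (initialWord k ω) = listMap f (seqPrefix k ω) := by
  rw [wordMap_eq_listMap, seqPrefix_eq_ofFn]

theorem listMap_append {α X : Type*} (f : α → X → X) (v w : List α) :
    listMap f (v ++ w) = listMap f v ∘ listMap f w := by
  induction v with
  | nil => rfl
  | cons i v ih => simp [listMap, ih, Function.comp_assoc]

theorem wordRatio_append {α : Type*} (ρ : α → ℝ) (v w : List α) :
    wordRatio ρ (v ++ w) = wordRatio ρ v * wordRatio ρ w := by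
  simp [wordRatio]

theorem wordRatio_pos {α : Type*} {ρ : α → ℝ} (hρ : ∀ i, 0 < ρ i) (w : List α) :
    0 < wordRatio ρ w := by
  apply List.prod_pos
  simpa using fun i _ => hρ i

theorem wordRatio_le_pow {α : Type*} {ρ : α → ℝ} {b : ℝ} (hρ : ∀ i, 0 < ρ i)
    (hb : ∀ i, ρ i ≤ b) (w : List α) : wordRatio ρ w ≤ b ^ w.length := by
  induction w with
  | nil => simp [wordRatio]
  | cons i w ih =>
    have := mul_le_mul (hb i) ih (wordRatio_pos hρ w).le ((hρ i).le.trans (hb i))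
    simpa [wordRatio, pow_succ'] using this

theorem pow_le_wordRatio {α : Type*} {ρ : α → ℝ} {a : ℝ} (ha0 : 0 < a) (ha : ∀ i, a ≤ ρ i)
    (w : List α) : a ^ w.length ≤ wordRatio ρ w := by
  induction w with
  | nil => simp [wordRatio]
  | cons i w ih =>
    have := mul_le_mul (ha i) ih (by positivity) (ha0.le.trans (ha i))
    simpa [wordRatio, pow_succ'] using this

theorem ShiftClosed.shift_mem {N : ℕ} {S : Set (ℕ → Fin N)} (hS : ShiftClosed S) (k : ℕ)
    {ω : ℕ → Fin N} (hω : ω ∈ S) : (fun j => ω (j + k)) ∈ S := by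
  induction k with
  | zero => simpa using hω
  | succ k ih => simpa [Nat.add_assoc, Nat.add_comm 1] using hS _ ih

/-- The finite set of the prefixes of length `k` of the sequences in `S`. -/
noncomputable def prefixes {N : ℕ} (S : Set (ℕ → Fin N)) (k : ℕ) : Finset (List (Fin N)) :=
  (Set.toFinite (initialWords S k)).toFinset.image List.ofFn

theorem mem_prefixes {N : ℕ} {S : Set (ℕ → Fin N)} {k : ℕ} {w : List (Fin N)} :
    w ∈ prefixes S k ↔ ∃ ω ∈ S, seqPrefix k ω = w := by
  simp [prefixes, initialWords, seqPrefix_eq_ofFn]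

theorem length_of_mem_prefixes {N : ℕ} {S : Set (ℕ → Fin N)} {k : ℕ} {w : List (Fin N)}
    (hw : w ∈ prefixes S k) : w.length = k := by
  obtain ⟨ω, -, rfl⟩ := mem_prefixes.1 hw
  exact seqPrefix_length _ _

theorem ratioSum_eq {N : ℕ} (ρ : Fin N → ℝ) (S : Set (ℕ → Fin N)) (t : ℝ) (k : ℕ) :
    ratioSum ρ S t k = ∑ w ∈ prefixes S k, wordRatio ρ w ^ t := by
  rw [prefixes, Finset.sum_image (fun _ _ _ _ h => List.ofFn_injective h), ratioSum]
  refine Finset.sum_congr rfl fun w _ => ?_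
  simp [wordRatio, List.map_ofFn, List.prod_ofFn]

/-! ### Growth of the ratio sums -/

theorem ratioSum_pos {N : ℕ} {ρ : Fin N → ℝ} (hρ : ∀ i, 0 < ρ i) {S : Set (ℕ → Fin N)}
    (hS : S.Nonempty) (t : ℝ) (k : ℕ) : 0 < ratioSum ρ S t k := by
  rw [ratioSum_eq]
  refine Finset.sum_pos (fun w _ => Real.rpow_pos_of_pos (wordRatio_pos hρ w) t) ?_
  obtain ⟨ω, hω⟩ := hS
  exact ⟨_, mem_prefixes.2 ⟨ω, hω, rfl⟩⟩

theorem one_le_ratioSum_zero {N : ℕ} {ρ : Fin N → ℝ} {S : Set (ℕ → Fin N)}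
    (hS : S.Nonempty) (k : ℕ) : 1 ≤ ratioSum ρ S 0 k := by
  obtain ⟨ω, hω⟩ := hS
  have : 0 < (prefixes S k).card := Finset.card_pos.2 ⟨_, mem_prefixes.2 ⟨ω, hω, rfl⟩⟩
  rw [ratioSum_eq]
  simpa using Nat.one_le_iff_ne_zero.2 this.ne'

/-- With its counterpart below, this controls the growth rate as the exponent varies: a word of
length `k` has ratio between `a ^ k` and `b ^ k`. -/
theorem ratioSum_add_le_pow_mul {N : ℕ} {ρ : Fin N → ℝ} {b : ℝ} (hρ : ∀ i, 0 < ρ i)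
    (hb : ∀ i, ρ i ≤ b) (hb0 : 0 < b) (S : Set (ℕ → Fin N)) (t : ℝ) {h : ℝ} (hh : 0 ≤ h)
    (k : ℕ) : ratioSum ρ S (t + h) k ≤ (b ^ h) ^ k * ratioSum ρ S t k := by
  rw [ratioSum_eq, ratioSum_eq, Finset.mul_sum]
  refine Finset.sum_le_sum fun w hw => ?_
  have h0 := wordRatio_pos hρ w
  rw [Real.rpow_add h0, mul_comm]
  gcongr
  rw [← Real.rpow_natCast, ← Real.rpow_mul hb0.le, mul_comm, Real.rpow_mul hb0.le,
    Real.rpow_natCast]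
  gcongr
  simpa [length_of_mem_prefixes hw] using wordRatio_le_pow hρ hb w

theorem pow_mul_le_ratioSum_add {N : ℕ} {ρ : Fin N → ℝ} {a : ℝ} (ha0 : 0 < a)
    (ha : ∀ i, a ≤ ρ i) (S : Set (ℕ → Fin N)) (t : ℝ) {h : ℝ} (hh : 0 ≤ h)
    (k : ℕ) : (a ^ h) ^ k * ratioSum ρ S t k ≤ ratioSum ρ S (t + h) k := by
  rw [ratioSum_eq, ratioSum_eq, Finset.mul_sum]
  refine Finset.sum_le_sum fun w hw => ?_
  have h0 := wordRatio_pos (fun i => ha0.trans_le (ha i)) w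
  rw [Real.rpow_add h0, mul_comm]
  gcongr
  rw [← Real.rpow_natCast, ← Real.rpow_mul ha0.le, mul_comm, Real.rpow_mul ha0.le,
    Real.rpow_natCast]
  gcongr
  simpa [length_of_mem_prefixes hw] using pow_le_wordRatio ha0 ha w

/-- If every sequence in `S` has a prefix of length at most `k` in `W`, the sum for words of
length `k` splits according to these prefixes. -/
theorem ratioSum_le_sum_mul {N : ℕ} {ρ : Fin N → ℝ} (hρ : ∀ i, 0 < ρ i) {S : Set (ℕ → Fin N)}
    (hS : ShiftClosed S) (W : Finset (List (Fin N))) (t : ℝ) (k : ℕ)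
    (hW : ∀ ω ∈ S, ∃ m ≤ k, seqPrefix m ω ∈ W) :
    ratioSum ρ S t k ≤ ∑ w ∈ W, wordRatio ρ w ^ t * ratioSum ρ S t (k - w.length) := by
  classical
  -- Only an inclusion: the tail after a prefix is again in `S`, but a concatenation of two
  -- admissible words need not be admissible.
  have hsub : prefixes S k ⊆
      (W.sigma fun w => prefixes S (k - w.length)).image fun p => p.1 ++ p.2 := by
    intro w hw
    obtain ⟨ω, hω, rfl⟩ := mem_prefixes.1 hw
    obtain ⟨m, hm, hmW⟩ := hW ω hω
    refine Finset.mem_image.2 ⟨⟨seqPrefix m ω, seqPrefix (k - m) fun j => ω (j + m)⟩, ?_, ?_⟩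
    · simp only [Finset.mem_sigma, seqPrefix_length]
      exact ⟨hmW, mem_prefixes.2 ⟨_, hS.shift_mem m hω, rfl⟩⟩
    · rw [← seqPrefix_add, Nat.add_sub_cancel' hm]
  have hpos : ∀ w : List (Fin N), 0 ≤ wordRatio ρ w ^ t := fun w =>
    Real.rpow_nonneg (wordRatio_pos hρ w).le t
  rw [ratioSum_eq]
  calc ∑ w ∈ prefixes S k, wordRatio ρ w ^ t
      ≤ ∑ w ∈ (W.sigma fun w => prefixes S (k - w.length)).image fun p => p.1 ++ p.2,
          wordRatio ρ w ^ t := Finset.sum_le_sum_of_subset_of_nonneg hsub fun w _ _ => hpos w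
    _ ≤ ∑ p ∈ W.sigma fun w => prefixes S (k - w.length), wordRatio ρ (p.1 ++ p.2) ^ t :=
        Finset.sum_image_le_of_nonneg fun p _ => hpos _
    _ = _ := by
        rw [Finset.sum_sigma]
        refine Finset.sum_congr rfl fun w _ => ?_
        rw [ratioSum_eq, Finset.mul_sum]
        refine Finset.sum_congr rfl fun v _ => ?_
        rw [wordRatio_append, Real.mul_rpow (wordRatio_pos hρ _).le (wordRatio_pos hρ _).le]

theorem ratioSum_add_le_mul {N : ℕ} {ρ : Fin N → ℝ} (hρ : ∀ i, 0 < ρ i) {S : Set (ℕ → Fin N)}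
    (hS : ShiftClosed S) (t : ℝ) (m k : ℕ) :
    ratioSum ρ S t (m + k) ≤ ratioSum ρ S t m * ratioSum ρ S t k := by
  refine (ratioSum_le_sum_mul hρ hS (prefixes S m) t (m + k)
    fun ω hω => ⟨m, by omega, mem_prefixes.2 ⟨ω, hω, rfl⟩⟩).trans_eq ?_
  rw [ratioSum_eq ρ S t m, Finset.sum_mul]
  refine Finset.sum_congr rfl fun w hw => ?_
  rw [length_of_mem_prefixes hw, Nat.add_sub_cancel_left]

/-- If every sequence in `S` has a non-empty prefix in a finite set `W` with
`∑_{w ∈ W} ρ_w ^ t ≤ 1`, then the sums `ratioSum ρ S t k` are bounded. -/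
theorem ratioSum_bounded {N : ℕ} {ρ : Fin N → ℝ} (hρ : ∀ i, 0 < ρ i) {S : Set (ℕ → Fin N)}
    (hS : ShiftClosed S) (W : Finset (List (Fin N))) (t : ℝ) (hnil : [] ∉ W)
    (hW : ∀ ω ∈ S, ∃ m, seqPrefix m ω ∈ W) (hsum : ∑ w ∈ W, wordRatio ρ w ^ t ≤ 1) :
    ∃ B : ℝ, ∀ k, ratioSum ρ S t k ≤ B := by
  set L := W.sup List.length
  have hnn : ∀ k, 0 ≤ ratioSum ρ S t k := fun k => by
    rw [ratioSum_eq]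
    exact Finset.sum_nonneg fun w _ => Real.rpow_nonneg (wordRatio_pos hρ w).le t
  refine ⟨1 + ∑ j ∈ Finset.range L, ratioSum ρ S t j, fun k => ?_⟩
  set B := 1 + ∑ j ∈ Finset.range L, ratioSum ρ S t j
  have hB : 0 ≤ B := add_nonneg zero_le_one (Finset.sum_nonneg fun j _ => hnn j)
  -- Beyond the longest word of `W`, the sum at `k` is at most a combination of earlier sums with
  -- total weight at most `1`.
  induction k using Nat.strong_induction_on with
  | _ k ih =>
    rcases lt_or_ge k L with hk | hk
    · have := Finset.single_le_sum (fun j _ => hnn j) (Finset.mem_range.2 hk)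
      simp only [B]; linarith
    · refine (ratioSum_le_sum_mul hρ hS W t k fun ω hω => ?_).trans ?_
      · obtain ⟨m, hm⟩ := hW ω hω
        have := Finset.le_sup (f := List.length) hm
        rw [seqPrefix_length] at this
        exact ⟨m, this.trans hk, hm⟩
      · calc ∑ w ∈ W, wordRatio ρ w ^ t * ratioSum ρ S t (k - w.length)
            ≤ ∑ w ∈ W, wordRatio ρ w ^ t * B := by
              refine Finset.sum_le_sum fun w hw => mul_le_mul_of_nonneg_left (ih _ ?_)
                (Real.rpow_nonneg (wordRatio_pos hρ w).le t)
              have h1 : w.length ≤ L := Finset.le_sup (f := List.length) hw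
              have h2 : w.length ≠ 0 := fun h => hnil (List.length_eq_zero_iff.1 h ▸ hw)
              omega
          _ ≤ B := by
              rw [← Finset.sum_mul]
              exact mul_le_of_le_one_left hB hsum

theorem tauEqOne_iff {N : ℕ} {ρ : Fin N → ℝ} (hρ : ∀ i, 0 < ρ i) {S : Set (ℕ → Fin N)}
    (hS : S.Nonempty) (t : ℝ) :
    TauEqOne ρ S t ↔ Tendsto (fun k : ℕ => Real.log (ratioSum ρ S t k) / k) atTop (𝓝 0) := by
  -- This includes `k = 0`: division by zero gives `0`, and both sides equal `1`.
  have h : ∀ k : ℕ, ratioSum ρ S t k ^ (1 / (k : ℝ)) =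
      Real.exp (Real.log (ratioSum ρ S t k) / k) := fun k => by
    rw [Real.rpow_def_of_pos (ratioSum_pos hρ hS t k), mul_one_div]
  unfold TauEqOne
  simp_rw [h]
  constructor
  · intro H
    simpa using H.log one_ne_zero
  · intro H
    simpa using H.rexp

theorem log_ratioSum_add_le {N : ℕ} {ρ : Fin N → ℝ} {b : ℝ} (hρ : ∀ i, 0 < ρ i)
    (hb : ∀ i, ρ i ≤ b) (hb0 : 0 < b) {S : Set (ℕ → Fin N)} (hS : S.Nonempty) (t : ℝ) {h : ℝ}
    (hh : 0 ≤ h) {k : ℕ} (hk : k ≠ 0) :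
    Real.log (ratioSum ρ S (t + h) k) / k ≤ h * Real.log b + Real.log (ratioSum ρ S t k) / k := by
  have hk' : (0 : ℝ) < k := by positivity
  have := Real.log_le_log (ratioSum_pos hρ hS _ k) (ratioSum_add_le_pow_mul hρ hb hb0 S t hh k)
  rw [Real.log_mul (by positivity) (ratioSum_pos hρ hS _ k).ne', Real.log_pow,
    Real.log_rpow hb0] at this
  rw [div_le_iff₀ hk', add_mul, div_mul_cancel₀ _ hk'.ne']
  linarith

theorem le_log_ratioSum_add {N : ℕ} {ρ : Fin N → ℝ} {a : ℝ} (ha0 : 0 < a)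
    (ha : ∀ i, a ≤ ρ i) {S : Set (ℕ → Fin N)} (hS : S.Nonempty) (t : ℝ) {h : ℝ}
    (hh : 0 ≤ h) {k : ℕ} (hk : k ≠ 0) :
    h * Real.log a + Real.log (ratioSum ρ S t k) / k ≤ Real.log (ratioSum ρ S (t + h) k) / k := by
  have hρ : ∀ i, 0 < ρ i := fun i => ha0.trans_le (ha i)
  have hk' : (0 : ℝ) < k := by positivity
  have hp := ratioSum_pos hρ hS t k
  have := Real.log_le_log (by positivity) (pow_mul_le_ratioSum_add ha0 ha S t hh k)
  rw [Real.log_mul (by positivity) hp.ne', Real.log_pow, Real.log_rpow ha0] at this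
  rw [le_div_iff₀ hk', add_mul, div_mul_cancel₀ _ hk'.ne']
  linarith

/-- The exponential growth rate of the ratio sums exists. -/
theorem exists_tendsto_log_ratioSum {N : ℕ} {ρ : Fin N → ℝ} {a : ℝ} (ha0 : 0 < a)
    (ha : ∀ i, a ≤ ρ i) {S : Set (ℕ → Fin N)} (hS : S.Nonempty) (hshift : ShiftClosed S)
    {t : ℝ} (ht : 0 ≤ t) :
    ∃ p, Tendsto (fun k : ℕ => Real.log (ratioSum ρ S t k) / k) atTop (𝓝 p) := by
  have hρ : ∀ i, 0 < ρ i := fun i => ha0.trans_le (ha i)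
  have hsub : Subadditive fun k : ℕ => Real.log (ratioSum ρ S t k) := fun m k => by
    rw [← Real.log_mul (ratioSum_pos hρ hS t m).ne' (ratioSum_pos hρ hS t k).ne']
    exact Real.log_le_log (ratioSum_pos hρ hS _ _) (ratioSum_add_le_mul hρ hshift t m k)
  -- Fekete's lemma. The lower bound compares with exponent `0`, where the sums count words; the `0`
  -- in the minimum covers `k = 0`.
  refine ⟨_, hsub.tendsto_lim ⟨min 0 (t * Real.log a), ?_⟩⟩
  rintro _ ⟨k, rfl⟩
  rcases eq_or_ne k 0 with rfl | hk
  · simp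
  · refine (min_le_right _ _).trans ?_
    have h1 := le_log_ratioSum_add ha0 ha hS 0 ht hk
    have h2 : 0 ≤ Real.log (ratioSum ρ S 0 k) / k :=
      div_nonneg (Real.log_nonneg (one_le_ratioSum_zero hS k)) k.cast_nonneg
    rw [zero_add] at h1
    exact (le_add_of_nonneg_right h2).trans h1

theorem existsUnique_tauEqOne {N : ℕ} {ρ : Fin N → ℝ} {a b : ℝ} (ha0 : 0 < a)
    (ha : ∀ i, a ≤ ρ i) (hb : ∀ i, ρ i ≤ b) (hb0 : 0 < b) (hb1 : b < 1) {S : Set (ℕ → Fin N)}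
    (hS : S.Nonempty) (hshift : ShiftClosed S) :
    ∃! s : ℝ, 0 ≤ s ∧ TauEqOne ρ S s := by
  have hρ : ∀ i, 0 < ρ i := fun i => ha0.trans_le (ha i)
  have hlb : Real.log b < 0 := Real.log_neg hb0 hb1
  simp_rw [tauEqOne_iff hρ hS]
  choose! P hP using fun t (ht : 0 ≤ t) => exists_tendsto_log_ratioSum ha0 ha hS hshift ht
  have hle : ∀ t h, 0 ≤ t → 0 ≤ h → P (t + h) ≤ h * Real.log b + P t := fun t h ht hh =>
    le_of_tendsto_of_tendsto (hP _ (add_nonneg ht hh)) ((hP t ht).const_add _)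
      ((eventually_ne_atTop 0).mono fun k hk => log_ratioSum_add_le hρ hb hb0 hS t hh hk)
  have hge : ∀ t h, 0 ≤ t → 0 ≤ h → h * Real.log a + P t ≤ P (t + h) := fun t h ht hh =>
    le_of_tendsto_of_tendsto ((hP t ht).const_add _) (hP _ (add_nonneg ht hh))
      ((eventually_ne_atTop 0).mono fun k hk => le_log_ratioSum_add ha0 ha hS t hh hk)
  have hP0 : 0 ≤ P 0 := ge_of_tendsto' (hP 0 le_rfl) fun k =>
    div_nonneg (Real.log_nonneg (one_le_ratioSum_zero hS k)) k.cast_nonneg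
  have hcont : ContinuousOn P (Set.Ici 0) := by
    have : LipschitzOnWith (Real.toNNReal |Real.log a|) P (Set.Ici 0) := by
      apply LipschitzOnWith.of_le_add_mul'
      intro x hx y hy
      rcases le_total x y with hxy | hxy
      · have := hge x (y - x) hx (sub_nonneg.2 hxy)
        rw [add_sub_cancel] at this
        rw [Real.dist_eq, abs_sub_comm, abs_of_nonneg (sub_nonneg.2 hxy)]
        nlinarith [neg_abs_le (Real.log a), mul_le_mul_of_nonneg_right
          (neg_abs_le (Real.log a)) (sub_nonneg.2 hxy)]
      · have := hle y (x - y) hy (sub_nonneg.2 hxy)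
        rw [add_sub_cancel] at this
        have h1 := mul_nonneg (abs_nonneg (Real.log a)) (dist_nonneg (x := x) (y := y))
        nlinarith [mul_nonneg (sub_nonneg.2 hxy) (neg_nonneg.2 hlb.le)]
    exact this.continuousOn
  obtain ⟨T, hT0, hT⟩ : ∃ T, 0 ≤ T ∧ P T ≤ 0 := by
    -- The point where the linear upper bound `P 0 + T * log b` vanishes.
    refine ⟨P 0 / (-Real.log b), div_nonneg hP0 (by linarith), ?_⟩
    have := hle 0 (P 0 / (-Real.log b)) le_rfl (div_nonneg hP0 (by linarith))
    rw [zero_add] at this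
    refine this.trans (le_of_eq ?_)
    field_simp [hlb.ne]
    ring
  obtain ⟨s, hs, hs0⟩ := intermediate_value_Icc' hT0
    (hcont.mono Set.Icc_subset_Ici_self) ⟨hT, hP0⟩
  refine ⟨s, ⟨hs.1, hs0 ▸ hP s hs.1⟩, ?_⟩
  rintro r ⟨hr, hr0⟩
  have hPr : P r = 0 := tendsto_nhds_unique (hP r hr) hr0
  rcases lt_trichotomy r s with h | h | h
  · have := hle r (s - r) hr (by linarith)
    rw [add_sub_cancel] at this
    nlinarith
  · exact h
  · have := hle s (r - s) hs.1 (by linarith)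
    rw [add_sub_cancel] at this
    nlinarith

/-- If the sums at `t` were bounded, the rate at `s` would be at most `(s - t) * log b < 0`. -/
theorem not_ratioSum_bounded_of_lt {N : ℕ} {ρ : Fin N → ℝ} {b : ℝ} (hρ : ∀ i, 0 < ρ i)
    (hb : ∀ i, ρ i ≤ b) (hb0 : 0 < b) (hb1 : b < 1) {S : Set (ℕ → Fin N)} (hS : S.Nonempty)
    {s t : ℝ} (hs : TauEqOne ρ S s) (hts : t < s) {B : ℝ}
    (hB : ∀ k, ratioSum ρ S t k ≤ B) : False := by
  rw [tauEqOne_iff hρ hS] at hs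
  have hlim : Tendsto (fun k : ℕ => (s - t) * Real.log b + Real.log B / k) atTop
      (𝓝 ((s - t) * Real.log b + 0)) :=
    (tendsto_const_div_atTop_nhds_zero_nat _).const_add _
  have := le_of_tendsto_of_tendsto hs hlim ((eventually_ne_atTop 0).mono fun k hk => ?_)
  · have := Real.log_neg hb0 hb1
    nlinarith
  · have h1 := log_ratioSum_add_le hρ hb hb0 hS t (sub_nonneg.2 hts.le) hk
    rw [add_sub_cancel] at h1
    refine h1.trans ?_
    exact add_le_add le_rfl (div_le_div_of_nonneg_right
      (Real.log_le_log (ratioSum_pos hρ hS t k) (hB k)) k.cast_nonneg)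

theorem tendsto_ratioSum_of_lt {N : ℕ} {ρ : Fin N → ℝ} {b : ℝ} (hρ : ∀ i, 0 < ρ i)
    (hb : ∀ i, ρ i ≤ b) (hb0 : 0 < b) (hb1 : b < 1) {S : Set (ℕ → Fin N)} (hS : S.Nonempty)
    {s t : ℝ} (hs : TauEqOne ρ S s) (hst : s < t) :
    Tendsto (ratioSum ρ S t) atTop (𝓝 0) := by
  rw [tauEqOne_iff hρ hS] at hs
  have hlb := Real.log_neg hb0 hb1
  -- The rate at `t` is at most `2 * c`; half of it absorbs the error in the convergence at `s`.
  set c := (t - s) * Real.log b / 2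
  have hc : c < 0 := by simp only [c]; nlinarith
  have hexp : Tendsto (fun k : ℕ => Real.exp c ^ k) atTop (𝓝 0) :=
    tendsto_pow_atTop_nhds_zero_of_lt_one (Real.exp_pos c).le (Real.exp_lt_one_iff.2 hc)
  refine tendsto_of_tendsto_of_tendsto_of_le_of_le' tendsto_const_nhds hexp
    (Eventually.of_forall fun k => (ratioSum_pos hρ hS t k).le) ?_
  filter_upwards [hs.eventually_lt_const (u := -c) (by linarith), eventually_ne_atTop 0]
    with k hk hk0
  have h1 := log_ratioSum_add_le hρ hb hb0 hS s (sub_nonneg.2 hst.le) hk0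
  rw [add_sub_cancel] at h1
  have hk' : (0 : ℝ) < k := by positivity
  have h2 : Real.log (ratioSum ρ S t k) / k ≤ c := by
    have : (t - s) * Real.log b = 2 * c := by simp only [c]; ring
    linarith
  rw [div_le_iff₀ hk'] at h2
  rw [← Real.exp_nat_mul, mul_comm, ← Real.log_le_iff_le_exp (ratioSum_pos hρ hS t k)]
  exact h2

/-! ### Similarities -/

theorem dist_listMap {α X : Type*} [MetricSpace X] {f : α → X → X} {ρ : α → ℝ}
    (hf : ∀ i, IsContractingSimilarity (f i) (ρ i)) (w : List α) (x y : X) :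
    dist (listMap f w x) (listMap f w y) = wordRatio ρ w * dist x y := by
  induction w with
  | nil => simp [listMap, wordRatio]
  | cons i w ih =>
    simp only [listMap, Function.comp_apply, (hf i).2.2, ih]
    simp [wordRatio, mul_assoc]

theorem continuous_listMap {α X : Type*} [MetricSpace X] {f : α → X → X} {ρ : α → ℝ}
    (hf : ∀ i, IsContractingSimilarity (f i) (ρ i)) (w : List α) :
    Continuous (listMap f w) :=
  (LipschitzWith.of_dist_le' fun x y => (dist_listMap hf w x y).le).continuous

theorem dimH_listMap_image {α X : Type*} [MetricSpace X] {f : α → X → X} {ρ : α → ℝ}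
    (hf : ∀ i, IsContractingSimilarity (f i) (ρ i)) (w : List α) (A : Set X) :
    dimH (listMap f w '' A) = dimH A := by
  have hpos := wordRatio_pos (fun i => (hf i).1) w
  apply le_antisymm
  · exact (LipschitzWith.of_dist_le' fun x y => (dist_listMap hf w x y).le).dimH_image_le A
  · refine AntilipschitzWith.le_dimH_image (K := (wordRatio ρ w)⁻¹.toNNReal)
      (AntilipschitzWith.of_le_mul_dist fun x y => ?_) A
    rw [dist_listMap hf, Real.coe_toNNReal _ (by positivity), inv_mul_cancel_left₀ hpos.ne']

theorem ediam_listMap_image {α X : Type*} [MetricSpace X] {f : α → X → X} {ρ : α → ℝ}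
    (hf : ∀ i, IsContractingSimilarity (f i) (ρ i)) (w : List α) (A : Set X) :
    Metric.ediam (listMap f w '' A) ≤ ENNReal.ofReal (wordRatio ρ w) * Metric.ediam A :=
  (LipschitzWith.of_dist_le' fun x y => (dist_listMap hf w x y).le).ediam_image_le A

/-- Rescaling by `r⁻¹` gives an isometry, which is affine by strict convexity and hence onto in
finite dimension. -/
theorem surjective_of_dist_eq_mul {X : Type*} [NormedAddCommGroup X] [NormedSpace ℝ X]
    [StrictConvexSpace ℝ X] [FiniteDimensional ℝ X] {g : X → X} {r : ℝ} (hr : 0 < r)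
    (hg : ∀ x y, dist (g x) (g y) = r * dist x y) : Function.Surjective g := by
  have hi : Isometry fun x => r⁻¹ • g x := Isometry.of_dist_eq fun x y => by
    rw [dist_smul₀, hg, Real.norm_of_nonneg (by positivity), inv_mul_cancel_left₀ hr.ne']
  have : Inhabited X := ⟨0⟩
  intro y
  obtain ⟨x, hx⟩ := (hi.affineIsometryOfStrictConvexSpace.toAffineIsometryEquiv rfl).surjective
    (r⁻¹ • y)
  exact ⟨x, smul_right_injective X (inv_ne_zero hr.ne') hx⟩

theorem listMap_image_subset {α X : Type*} {f : α → X → X} {V : Set X}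
    (hV : ∀ i, f i '' V ⊆ V) (w : List α) : listMap f w '' V ⊆ V := by
  induction w with
  | nil => simp [listMap]
  | cons i w ih =>
    rw [listMap, Set.image_comp]
    exact (Set.image_mono ih).trans (hV i)

/-- Strip the common prefix: at the first differing letter the images of `V` separate. -/
theorem disjoint_listMap_image {α X : Type*} {f : α → X → X} (hinj : ∀ i, (f i).Injective)
    {V : Set X} (hV : ∀ i, f i '' V ⊆ V)
    (hdisj : ∀ i j, i ≠ j → Disjoint (f i '' V) (f j '' V)) {v w : List α}
    (hvw : ¬ v <+: w) (hwv : ¬ w <+: v) : Disjoint (listMap f v '' V) (listMap f w '' V) := by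
  induction v generalizing w with
  | nil => exact absurd List.nil_prefix hvw
  | cons i v ih =>
    cases w with
    | nil => exact absurd List.nil_prefix hwv
    | cons j w =>
      simp only [listMap, Set.image_comp]
      by_cases hij : i = j
      · subst hij
        refine (Set.disjoint_image_iff (hinj i)).2 (ih ?_ ?_)
        · simpa using hvw
        · simpa using hwv
      · exact (hdisj i j hij).mono (Set.image_mono (listMap_image_subset hV v))
          (Set.image_mono (listMap_image_subset hV w))

/-! ### Words at a given scale -/

/-- The word `w` has ratio at most `r`, and all of its proper prefixes have ratio above `r`. -/
def IsStopping {α : Type*} (ρ : α → ℝ) (r : ℝ) (w : List α) : Prop :=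
  wordRatio ρ w ≤ r ∧ ∀ v, v <+: w → v ≠ w → r < wordRatio ρ v

theorem IsStopping.not_isPrefix {α : Type*} {ρ : α → ℝ} {r : ℝ} {v w : List α}
    (hv : IsStopping ρ r v) (hw : IsStopping ρ r w) (h : v ≠ w) : ¬ v <+: w :=
  fun hp => (hw.2 v hp h).not_ge hv.1

theorem IsStopping.ne_nil {α : Type*} {ρ : α → ℝ} {r : ℝ} (hr : r < 1) {w : List α}
    (hw : IsStopping ρ r w) : w ≠ [] := by
  rintro rfl
  have : (1 : ℝ) ≤ r := by simpa [wordRatio] using hw.1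
  linarith

/-- Without its last letter the word has ratio above `r`, and that letter costs a factor of at least
`a`. -/
theorem IsStopping.mul_lt {α : Type*} {ρ : α → ℝ} {r a : ℝ} (hr0 : 0 < r) (hr : r < 1)
    (ha0 : 0 < a) (ha : ∀ i, a ≤ ρ i) {w : List α} (hw : IsStopping ρ r w) :
    a * r < wordRatio ρ w := by
  have hne := hw.ne_nil hr
  have hsplit := List.dropLast_append_getLast hne
  have h1 : r < wordRatio ρ w.dropLast := hw.2 _ (List.dropLast_prefix w) fun h => by
    have := congrArg List.length h
    have := List.length_pos_iff.2 hne
    simp at *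
    omega
  rw [← hsplit, wordRatio_append]
  have h2 : wordRatio ρ [w.getLast hne] = ρ (w.getLast hne) := by simp [wordRatio]
  rw [h2]
  nlinarith [ha (w.getLast hne)]

theorem exists_isStopping_seqPrefix {α : Type*} {ρ : α → ℝ} {b : ℝ} (hρ : ∀ i, 0 < ρ i)
    (hb : ∀ i, ρ i ≤ b) (hb1 : b < 1) {r : ℝ} (hr : 0 < r) (ω : ℕ → α) :
    ∃ k, IsStopping ρ r (seqPrefix k ω) := by
  classical
  have hex : ∃ k, wordRatio ρ (seqPrefix k ω) ≤ r := by
    obtain ⟨k, hk⟩ := exists_pow_lt_of_lt_one hr hb1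
    refine ⟨k, (wordRatio_le_pow hρ hb _).trans ?_⟩
    rw [seqPrefix_length]
    exact hk.le
  refine ⟨Nat.find hex, Nat.find_spec hex, fun v hv hne => ?_⟩
  have hv' := eq_seqPrefix_of_isPrefix hv
  have hlt : v.length < Nat.find hex := by
    refine lt_of_le_of_ne (by simpa [seqPrefix_length] using hv.length_le) fun h => hne ?_
    rw [hv', h]
  rw [hv']
  exact not_le.1 (Nat.find_min hex hlt)

/-- After rescaling to a fixed ball, each member of a finite cover by `δ / 2`-balls contains at most
one of the points. -/
theorem exists_card_le_of_separated {X ι : Type*} [NormedAddCommGroup X] [NormedSpace ℝ X]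
    [FiniteDimensional ℝ X] {δ : ℝ} (hδ : 0 < δ) (K : ℝ) :
    ∃ M : ℕ, ∀ (r : ℝ) (x : X) (p : ι → X) (F : Finset ι), 0 < r →
      (∀ i ∈ F, dist (p i) x ≤ K * r) →
      (∀ i ∈ F, ∀ j ∈ F, i ≠ j → δ * r ≤ dist (p i) (p j)) → F.card ≤ M := by
  have : ProperSpace X := FiniteDimensional.proper_real X
  obtain ⟨T, hTfin, hT⟩ := Metric.totallyBounded_iff.1
    (isCompact_closedBall (0 : X) K).totallyBounded (δ / 2) (half_pos hδ)
  refine ⟨hTfin.toFinset.card, fun r x p F hr hK hsep => ?_⟩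
  have hmem : ∀ i ∈ F, ∃ y ∈ T, dist (r⁻¹ • (p i - x)) y < δ / 2 := fun i hi => by
    have : r⁻¹ • (p i - x) ∈ Metric.closedBall (0 : X) K := by
      rw [mem_closedBall_zero_iff, norm_smul, ← dist_eq_norm, Real.norm_of_nonneg (by positivity),
        inv_mul_le_iff₀ hr, mul_comm]
      exact hK i hi
    simpa using hT this
  choose! y hyT hy using hmem
  by_contra! hcard
  obtain ⟨i, hi, j, hj, hij, hyij⟩ := Finset.exists_ne_map_eq_of_card_lt_of_maps_to hcard
    fun i hi => by simpa using hyT i hi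
  have h1 : dist (r⁻¹ • (p i - x)) (r⁻¹ • (p j - x)) < δ := by
    have h2 := hy j hj
    rw [← hyij, dist_comm] at h2
    linarith [dist_triangle (r⁻¹ • (p i - x)) (y i) (r⁻¹ • (p j - x)), hy i hi]
  rw [dist_smul₀, dist_sub_right, Real.norm_of_nonneg (by positivity), inv_mul_lt_iff₀ hr,
    mul_comm] at h1
  exact absurd (hsep i hi j hj hij) (not_le.2 h1)

/-- Under the open set condition, the number of words at scale `r` whose pieces lie near a given
ball of radius `r` is bounded independently of the ball and of `r`. -/
theorem exists_card_stopping_le {X : Type*} [NormedAddCommGroup X] [NormedSpace ℝ X]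
    [StrictConvexSpace ℝ X] [FiniteDimensional ℝ X] {N : ℕ} {f : Fin N → X → X} {ρ : Fin N → ℝ}
    (hf : ∀ i, IsContractingSimilarity (f i) (ρ i)) {a : ℝ} (ha0 : 0 < a) (ha : ∀ i, a ≤ ρ i)
    {V : Set X} (hVo : IsOpen V) (hV : ∀ i, f i '' V ⊆ V)
    (hdisj : ∀ i j, i ≠ j → Disjoint (f i '' V) (f j '' V)) {v : X} (hv : v ∈ V) (K : ℝ) :
    ∃ M : ℕ, ∀ (r : ℝ) (x : X) (F : Finset (List (Fin N))), 0 < r → r < 1 →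
      (∀ w ∈ F, IsStopping ρ r w ∧ dist (listMap f w v) x ≤ K * r) → F.card ≤ M := by
  obtain ⟨c, hc, hball⟩ := Metric.isOpen_iff.1 hVo v hv
  obtain ⟨M, hM⟩ := exists_card_le_of_separated (X := X) (ι := List (Fin N)) (mul_pos hc ha0) K
  refine ⟨M, fun r x F hr hr1 hF => hM r x (fun w => listMap f w v) F hr
    (fun w hw => (hF w hw).2) fun w hw u hu hne => ?_⟩
  have hupos := wordRatio_pos (fun i => (hf i).1) u
  have hinj : ∀ i, (f i).Injective := fun i x y hxy => by
    have := (hf i).2.2 x y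
    rw [hxy, dist_self] at this
    exact dist_eq_zero.1 ((mul_eq_zero.1 this.symm).resolve_left (hf i).1.ne')
  by_contra! hlt
  -- If `f_w(v)` is within `c * a * r` of `f_u(v)`, its preimage under `f_u` is within `c` of `v`,
  -- hence in `V`, so the disjoint images of `V` would meet.
  obtain ⟨z, hz⟩ := surjective_of_dist_eq_mul hupos (dist_listMap hf u) (listMap f w v)
  have hzV : z ∈ V := by
    refine hball (Metric.mem_ball.2 ?_)
    have h1 : wordRatio ρ u * dist z v < c * a * r := by rwa [← dist_listMap hf, hz]
    have h2 := (hF u hu).1.mul_lt hr hr1 ha0 ha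
    have h3 : wordRatio ρ u * dist z v < wordRatio ρ u * c := by nlinarith
    exact lt_of_mul_lt_mul_left h3 hupos.le
  exact Set.disjoint_left.1 (disjoint_listMap_image hinj hV hdisj
    ((hF w hw).1.not_isPrefix (hF u hu).1 hne) ((hF u hu).1.not_isPrefix (hF w hw).1 hne.symm))
    ⟨v, hv, rfl⟩ ⟨z, hzV, hz⟩

/-! ### The coding map -/

/-- `y` is the point coded by the sequence `ω`. -/
def IsCodedBy {X : Type*} [MetricSpace X] {N : ℕ} (f : Fin N → X → X) (ω : ℕ → Fin N)
    (y : X) : Prop :=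
  ∀ x : X, Tendsto (fun k => listMap f (seqPrefix k ω) x) atTop (𝓝 y)

theorem mem_codedSet {X : Type*} [MetricSpace X] {N : ℕ} {f : Fin N → X → X}
    {S : Set (ℕ → Fin N)} {y : X} : y ∈ codedSet f S ↔ ∃ ω ∈ S, IsCodedBy f ω y := by
  simp only [codedSet, IsCodedBy, wordMap_initialWord, Set.mem_ofPred_eq]

theorem exists_isCodedBy {X : Type*} [MetricSpace X] [CompleteSpace X] [Nonempty X] {N : ℕ}
    {f : Fin N → X → X} {ρ : Fin N → ℝ} (hf : ∀ i, IsContractingSimilarity (f i) (ρ i)) {b : ℝ}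
    (hb : ∀ i, ρ i ≤ b) (hb0 : 0 < b) (hb1 : b < 1) (ω : ℕ → Fin N) :
    ∃ y, IsCodedBy f ω y := by
  have hρ : ∀ i, 0 < ρ i := fun i => (hf i).1
  obtain ⟨x₀⟩ := ‹Nonempty X›
  obtain ⟨D, hD⟩ := (Set.finite_range fun i => dist x₀ (f i x₀)).bddAbove
  have hle : ∀ k, wordRatio ρ (seqPrefix k ω) ≤ b ^ k := fun k => by
    simpa [seqPrefix_length] using wordRatio_le_pow hρ hb (seqPrefix k ω)
  have hD0 : 0 ≤ D := dist_nonneg.trans (hD ⟨ω 0, rfl⟩)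
  have hcauchy : CauchySeq fun k => listMap f (seqPrefix k ω) x₀ := by
    refine cauchySeq_of_le_geometric b D hb1 fun k => ?_
    rw [seqPrefix_succ, listMap_append, Function.comp_apply, dist_listMap hf, mul_comm D]
    exact mul_le_mul (hle k) (hD ⟨ω k, rfl⟩) dist_nonneg (by positivity)
  obtain ⟨y, hy⟩ := cauchySeq_tendsto_of_complete hcauchy
  refine ⟨y, fun x => ?_⟩
  refine (tendsto_iff_of_dist ?_).1 hy
  have h0 : Tendsto (fun k : ℕ => b ^ k * dist x₀ x) atTop (𝓝 0) := by
    simpa using (tendsto_pow_atTop_nhds_zero_of_lt_one hb0.le hb1).mul_const (dist x₀ x)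
  refine squeeze_zero (fun _ => dist_nonneg) (fun k => ?_) h0
  rw [dist_listMap hf]
  gcongr
  exact hle k

theorem IsCodedBy.eq {X : Type*} [MetricSpace X] {N : ℕ} {f : Fin N → X → X} {ω : ℕ → Fin N}
    {y z : X} (hy : IsCodedBy f ω y) (hz : IsCodedBy f ω z) : y = z :=
  tendsto_nhds_unique (hy y) (hz y)

theorem IsCodedBy.listMap_shift {X : Type*} [MetricSpace X] {N : ℕ} {f : Fin N → X → X}
    {ρ : Fin N → ℝ} (hf : ∀ i, IsContractingSimilarity (f i) (ρ i)) {ω : ℕ → Fin N} (k : ℕ)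
    {z : X} (hz : IsCodedBy f (fun j => ω (j + k)) z) :
    IsCodedBy f ω (listMap f (seqPrefix k ω) z) := fun x => by
  refine (tendsto_add_atTop_iff_nat k).1 ?_
  have : ∀ m, listMap f (seqPrefix (m + k) ω) x =
      listMap f (seqPrefix k ω) (listMap f (seqPrefix m fun j => ω (j + k)) x) := fun m => by
    rw [add_comm, seqPrefix_add, listMap_append, Function.comp_apply]
  simp_rw [this]
  exact ((continuous_listMap hf _).tendsto z).comp (hz x)

/-- A point coded by a sequence in `S` is the image under the map of each prefix of
a point of the coded set. -/
theorem IsCodedBy.exists_eq_listMap {X : Type*} [MetricSpace X] [CompleteSpace X] {N : ℕ}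
    {f : Fin N → X → X} {ρ : Fin N → ℝ} (hf : ∀ i, IsContractingSimilarity (f i) (ρ i)) {b : ℝ}
    (hb : ∀ i, ρ i ≤ b) (hb0 : 0 < b) (hb1 : b < 1) {S : Set (ℕ → Fin N)}
    (hS : ShiftClosed S) {ω : ℕ → Fin N} (hω : ω ∈ S) {y : X} (hy : IsCodedBy f ω y) (k : ℕ) :
    ∃ z ∈ codedSet f S, y = listMap f (seqPrefix k ω) z := by
  have : Nonempty X := ⟨y⟩
  obtain ⟨z, hz⟩ := exists_isCodedBy hf hb hb0 hb1 fun j => ω (j + k)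
  exact ⟨z, mem_codedSet.2 ⟨_, hS.shift_mem k hω, hz⟩, hy.eq (hz.listMap_shift hf k)⟩

/-! ### The dimension of the coded set -/

theorem dimH_codedSet_le {X : Type*} [MetricSpace X] [CompleteSpace X] [MeasurableSpace X]
    [BorelSpace X] {N : ℕ} {f : Fin N → X → X} {ρ : Fin N → ℝ}
    (hf : ∀ i, IsContractingSimilarity (f i) (ρ i)) {b : ℝ}
    (hb : ∀ i, ρ i ≤ b) (hb0 : 0 < b) (hb1 : b < 1) {S : Set (ℕ → Fin N)} (hS : S.Nonempty)
    (hshift : ShiftClosed S) (hbdd : Bornology.IsBounded (codedSet f S))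
    {s : ℝ} (hs0 : 0 ≤ s) (hs : TauEqOne ρ S s) :
    dimH (codedSet f S) ≤ ENNReal.ofReal s := by
  have hρ : ∀ i, 0 < ρ i := fun i => (hf i).1
  set E := codedSet f S
  by_contra! hlt
  obtain ⟨t, hst, ht⟩ := ENNReal.lt_iff_exists_nnreal_btwn.1 hlt
  have hst' : s < t := by
    rwa [ENNReal.ofReal_lt_iff_lt_toReal hs0 ENNReal.coe_ne_top, ENNReal.coe_toReal] at hst
  refine absurd (dimH_le_of_hausdorffMeasure_ne_top (d := t) ?_) (not_le.2 ht)
  have hD : Metric.ediam E ≠ ⊤ := hbdd.ediam_ne_top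
  have hDt : Metric.ediam E ^ (t : ℝ) ≠ ⊤ := ENNReal.rpow_ne_top_of_nonneg t.2 hD
  have hdiam : ∀ w, Metric.ediam (listMap f w '' E) ≤
      ENNReal.ofReal (wordRatio ρ w) * Metric.ediam E := fun w => ediam_listMap_image hf w E
  have hr : Tendsto (fun k : ℕ => ENNReal.ofReal (b ^ k) * Metric.ediam E) atTop (𝓝 0) := by
    have h1 := ENNReal.tendsto_ofReal (tendsto_pow_atTop_nhds_zero_of_lt_one hb0.le hb1)
    simpa using ENNReal.Tendsto.mul_const h1 (Or.inr hD)
  have hle := Measure.hausdorffMeasure_le_liminf_sum (t : ℝ) E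
    (ι := fun k => ↥(prefixes S k)) _ hr (fun k w => listMap f w.1 '' E)
    (Eventually.of_forall fun k w => (hdiam w).trans ?_)
    (Eventually.of_forall fun k y hy => ?_)
  · have hlim : Tendsto (fun k => ENNReal.ofReal (ratioSum ρ S t k) * Metric.ediam E ^ (t : ℝ))
        atTop (𝓝 0) := by
      have h1 := ENNReal.tendsto_ofReal (tendsto_ratioSum_of_lt hρ hb hb0 hb1 hS hs hst')
      simpa using ENNReal.Tendsto.mul_const h1 (Or.inr hDt)
    have hle' : μH[t] E ≤ 0 := by
      refine hle.trans ((liminf_le_liminf (Eventually.of_forall fun k => ?_)).trans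
        hlim.liminf_eq.le)
      rw [Finset.sum_coe_sort (prefixes S k) fun w => Metric.ediam (listMap f w '' E) ^ (t : ℝ),
        ratioSum_eq, ENNReal.ofReal_sum_of_nonneg
          fun w _ => Real.rpow_nonneg (wordRatio_pos hρ w).le _, Finset.sum_mul]
      refine Finset.sum_le_sum fun w _ => ?_
      rw [← ENNReal.ofReal_rpow_of_pos (wordRatio_pos hρ w), ← ENNReal.mul_rpow_of_nonneg _ _ t.coe_nonneg]
      exact ENNReal.rpow_le_rpow (hdiam w) t.2
    exact (hle'.trans_lt ENNReal.zero_lt_top).ne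
  · gcongr
    simpa [length_of_mem_prefixes w.2] using wordRatio_le_pow hρ hb w.1
  · obtain ⟨ω, hω, hy⟩ := mem_codedSet.1 hy
    obtain ⟨z, hz, rfl⟩ := hy.exists_eq_listMap hf hb hb0 hb1 hshift hω k
    exact Set.mem_iUnion.2 ⟨⟨_, mem_prefixes.2 ⟨ω, hω, rfl⟩⟩, z, hz, rfl⟩

/-- A compact set of zero `t`-dimensional Hausdorff measure has finite covers by small balls for
which the sum of the `t`-th powers of the radii is small. -/
theorem exists_finite_ball_cover_of_hausdorffMeasure_eq_zero {X : Type*} [MetricSpace X]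
    [MeasurableSpace X] [BorelSpace X] [Nonempty X] {E : Set X} (hE : IsCompact E) {t : ℝ}
    (ht : 0 < t) (h0 : μH[t] E = 0) {ε : ℝ} (hε : 0 < ε) :
    ∃ (F : Finset ℕ) (x : ℕ → X) (r : ℕ → ℝ), (∀ n, 0 < r n) ∧ (∀ n, r n < 1) ∧
      E ⊆ ⋃ n ∈ F, Metric.ball (x n) (r n) ∧ ∑ n ∈ F, r n ^ t ≤ ε := by
  have hε2 : (0 : ENNReal) < ENNReal.ofReal (ε / 2) := ENNReal.ofReal_pos.2 (half_pos hε)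
  -- Diameters at most `1 / 2` leave room for radii below `1`, which makes stopping words non-empty.
  have h1 : (⨅ (T : ℕ → Set X) (_ : E ⊆ ⋃ n, T n)
      (_ : ∀ n, Metric.ediam (T n) ≤ ENNReal.ofReal (1 / 2)),
      ∑' n, ⨆ _ : (T n).Nonempty, Metric.ediam (T n) ^ t) < ENNReal.ofReal (ε / 2) := by
    refine lt_of_le_of_lt ?_ hε2
    rw [← h0, Measure.hausdorffMeasure_apply]
    exact le_iSup₂ (f := fun (r : ENNReal) (_ : 0 < r) => ⨅ (T : ℕ → Set X) (_ : E ⊆ ⋃ n, T n)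
      (_ : ∀ n, Metric.ediam (T n) ≤ r), ∑' n, ⨆ _ : (T n).Nonempty, Metric.ediam (T n) ^ t)
      (ENNReal.ofReal (1 / 2)) (ENNReal.ofReal_pos.2 one_half_pos)
  simp only [iInf_lt_iff] at h1
  obtain ⟨T, hcov, hT, hsum⟩ := h1
  -- Summable errors pay for enlarging each set to an open ball of positive radius, even when its
  -- diameter is `0`.
  obtain ⟨e, he0, hesum⟩ := ENNReal.exists_pos_sum_of_countable hε2.ne' ℕ
  have hball : ∀ n, ∃ (x : X) (r : ℝ), 0 < r ∧ r < 1 ∧ T n ⊆ Metric.ball x r ∧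
      ENNReal.ofReal (r ^ t) ≤ (⨆ _ : (T n).Nonempty, Metric.ediam (T n) ^ t) + e n := by
    intro n
    have hfin : Metric.ediam (T n) ≠ ⊤ := ((hT n).trans_lt ENNReal.ofReal_lt_top).ne
    have hd1 : Metric.diam (T n) < 1 :=
      (ENNReal.toReal_le_of_le_ofReal (by norm_num) (hT n)).trans_lt (by norm_num)
    have hev : ∀ᶠ r in 𝓝[>] Metric.diam (T n), r ^ t < Metric.diam (T n) ^ t + e n := by
      have hc : Tendsto (fun r : ℝ => r ^ t) (𝓝[>] Metric.diam (T n))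
          (𝓝 (Metric.diam (T n) ^ t)) :=
        (Real.continuousAt_rpow_const _ _ (Or.inr ht.le)).tendsto.mono_left nhdsWithin_le_nhds
      exact hc.eventually_lt_const (lt_add_of_pos_right _ (he0 n))
    obtain ⟨r, hr, hr1, hr2⟩ := (hev.and (Ioo_mem_nhdsGT hd1)).exists
    have hsup : ENNReal.ofReal (Metric.diam (T n) ^ t) ≤
        ⨆ _ : (T n).Nonempty, Metric.ediam (T n) ^ t := by
      rcases (T n).eq_empty_or_nonempty with h | h
      · simp [h, Real.zero_rpow ht.ne']
      · rw [ciSup_pos h, Metric.diam, ← ENNReal.ofReal_rpow_of_nonneg ENNReal.toReal_nonneg ht.le,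
          ENNReal.ofReal_toReal hfin]
    have hrt : ENNReal.ofReal (r ^ t) ≤
        (⨆ _ : (T n).Nonempty, Metric.ediam (T n) ^ t) + e n := by
      refine (ENNReal.ofReal_le_ofReal hr.le).trans (ENNReal.ofReal_add_le.trans ?_)
      rw [ENNReal.ofReal_coe_nnreal]
      gcongr
    obtain ⟨x, hx⟩ : ∃ x, T n ⊆ Metric.ball x r := by
      rcases (T n).eq_empty_or_nonempty with h | ⟨x, hx⟩
      · exact ⟨Classical.arbitrary X, by simp [h]⟩
      · exact ⟨x, fun y hy => Metric.mem_ball.2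
          ((Metric.dist_le_diam_of_mem' hfin hy hx).trans_lt hr1)⟩
    exact ⟨x, r, Metric.diam_nonneg.trans_lt hr1, hr2, hx, hrt⟩
  choose x r hr0 hr1 hTb hrt using hball
  obtain ⟨F, hF⟩ := hE.elim_finite_subcover (fun n => Metric.ball (x n) (r n))
    (fun _ => Metric.isOpen_ball) (hcov.trans (Set.iUnion_mono hTb))
  refine ⟨F, x, r, hr0, hr1, hF, ?_⟩
  rw [← ENNReal.ofReal_le_ofReal_iff hε.le,
    ENNReal.ofReal_sum_of_nonneg fun n _ => Real.rpow_nonneg (hr0 n).le t]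
  calc ∑ n ∈ F, ENNReal.ofReal (r n ^ t)
      ≤ ∑ n ∈ F, ((⨆ _ : (T n).Nonempty, Metric.ediam (T n) ^ t) + e n) :=
        Finset.sum_le_sum fun n _ => hrt n
    _ ≤ ∑' n, ((⨆ _ : (T n).Nonempty, Metric.ediam (T n) ^ t) + e n) := ENNReal.sum_le_tsum F
    _ = (∑' n, ⨆ _ : (T n).Nonempty, Metric.ediam (T n) ^ t) + ∑' n, (e n : ENNReal) :=
        ENNReal.tsum_add
    _ ≤ ENNReal.ofReal (ε / 2) + ENNReal.ofReal (ε / 2) := add_le_add hsum.le hesum.le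
    _ = ENNReal.ofReal ε := by
        rw [← ENNReal.ofReal_add (half_pos hε).le (half_pos hε).le, add_halves]

theorem le_dimH_codedSet {X : Type*} [NormedAddCommGroup X] [NormedSpace ℝ X]
    [StrictConvexSpace ℝ X] [FiniteDimensional ℝ X] [MeasurableSpace X] [BorelSpace X]
    {N : ℕ} {f : Fin N → X → X} {ρ : Fin N → ℝ}
    (hf : ∀ i, IsContractingSimilarity (f i) (ρ i)) (hosc : OpenSetCondition f) {a b : ℝ}
    (ha0 : 0 < a) (ha : ∀ i, a ≤ ρ i) (hb : ∀ i, ρ i ≤ b) (hb0 : 0 < b) (hb1 : b < 1)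
    {S : Set (ℕ → Fin N)} (hS : S.Nonempty) (hshift : ShiftClosed S)
    (hcomp : IsCompact (codedSet f S)) {s : ℝ} (hs : TauEqOne ρ S s) :
    ENNReal.ofReal s ≤ dimH (codedSet f S) := by
  classical
  have : CompleteSpace X := FiniteDimensional.complete ℝ X
  have hρ : ∀ i, 0 < ρ i := fun i => (hf i).1
  by_contra! hlt
  obtain ⟨t, htE, hts⟩ := ENNReal.lt_iff_exists_nnreal_btwn.1 hlt
  have ht0 : (0 : ℝ) < t := by exact_mod_cast (zero_le (a := dimH (codedSet f S))).trans_lt htE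
  have hts' : (t : ℝ) < s := by
    rwa [ENNReal.lt_ofReal_iff_toReal_lt ENNReal.coe_ne_top, ENNReal.coe_toReal] at hts
  obtain ⟨V, hVo, ⟨v, hv⟩, hV, hdisj⟩ := hosc
  obtain ⟨R, hR⟩ := hcomp.isBounded.subset_closedBall v
  -- If `y = f_w(z)` lies in a ball of radius `r` and `w` stops at scale `r`, then `f_w(v)` is
  -- within `R * r` of `y`, so within `(R + 1) * r` of the centre.
  obtain ⟨M, hM⟩ := exists_card_stopping_le hf ha0 ha hVo hV hdisj hv (R + 1)
  obtain ⟨F, x, r, hr0, hr1, hcov, hsum⟩ :=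
    exists_finite_ball_cover_of_hausdorffMeasure_eq_zero hcomp ht0
      (hausdorffMeasure_of_dimH_lt htE) (ε := 1 / (M + 1)) (by positivity)
  have hfin : ∀ n, {w | IsStopping ρ (r n) w ∧
      dist (listMap f w v) (x n) ≤ (R + 1) * r n}.Finite := fun n => by
    by_contra hinf
    obtain ⟨A, hA, hcard⟩ := Set.Infinite.exists_subset_card_eq hinf (M + 1)
    have := hM (r n) (x n) A (hr0 n) (hr1 n) fun w hw => hA hw
    omega
  set A : ℕ → Finset (List (Fin N)) := fun n => (hfin n).toFinset
  have hA : ∀ n w, w ∈ A n ↔ IsStopping ρ (r n) w ∧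
      dist (listMap f w v) (x n) ≤ (R + 1) * r n := fun n w => by simp [A]
  have hAcard : ∀ n, ((A n).card : ℝ) ≤ M := fun n => by
    exact_mod_cast hM (r n) (x n) (A n) (hr0 n) (hr1 n) fun w hw => (hA n w).1 hw
  refine Exists.elim (ratioSum_bounded hρ hshift ((F.sigma A).image Sigma.snd) t ?_ ?_ ?_)
    fun B hB => not_ratioSum_bounded_of_lt hρ hb hb0 hb1 hS hs hts' hB
  · intro h
    obtain ⟨⟨n, w⟩, hw, rfl⟩ := Finset.mem_image.1 h
    exact ((hA n _).1 (Finset.mem_sigma.1 hw).2).1.ne_nil (hr1 n) rfl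
  · intro ω hω
    obtain ⟨y, hy⟩ := exists_isCodedBy hf hb hb0 hb1 ω
    obtain ⟨n, hn, hyn⟩ := Set.mem_iUnion₂.1 (hcov (mem_codedSet.2 ⟨ω, hω, hy⟩))
    obtain ⟨k, hk⟩ := exists_isStopping_seqPrefix hρ hb hb1 (hr0 n) ω
    refine ⟨k, Finset.mem_image.2 ⟨⟨n, _⟩, Finset.mem_sigma.2 ⟨hn, (hA n _).2 ⟨hk, ?_⟩⟩, rfl⟩⟩
    obtain ⟨z, hz, rfl⟩ := hy.exists_eq_listMap hf hb hb0 hb1 hshift hω k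
    have h1 : dist v z ≤ R := by rw [dist_comm]; exact hR hz
    have h2 := mul_le_mul hk.1 h1 dist_nonneg (hr0 n).le
    rw [← dist_listMap hf] at h2
    have h3 := dist_triangle (listMap f (seqPrefix k ω) v) (listMap f (seqPrefix k ω) z) (x n)
    have h4 := Metric.mem_ball.1 hyn
    linarith
  · have hnn : ∀ w : List (Fin N), 0 ≤ wordRatio ρ w ^ (t : ℝ) := fun w =>
      Real.rpow_nonneg (wordRatio_pos hρ w).le _
    calc ∑ w ∈ (F.sigma A).image Sigma.snd, wordRatio ρ w ^ (t : ℝ)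
        ≤ ∑ p ∈ F.sigma A, wordRatio ρ p.2 ^ (t : ℝ) :=
          Finset.sum_image_le_of_nonneg fun p _ => hnn p
      _ = ∑ n ∈ F, ∑ w ∈ A n, wordRatio ρ w ^ (t : ℝ) := Finset.sum_sigma _ _ _
      _ ≤ ∑ n ∈ F, M * r n ^ (t : ℝ) := by
          refine Finset.sum_le_sum fun n _ => ?_
          refine (Finset.sum_le_card_nsmul _ _ (r n ^ (t : ℝ)) fun w hw => ?_).trans ?_
          · exact Real.rpow_le_rpow (wordRatio_pos hρ w).le ((hA n w).1 hw).1.1 ht0.le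
          · rw [nsmul_eq_mul]
            exact mul_le_mul_of_nonneg_right (hAcard n) (Real.rpow_nonneg (hr0 n).le _)
      _ = M * ∑ n ∈ F, r n ^ (t : ℝ) := (Finset.mul_sum _ _ _).symm
      _ ≤ M * (1 / (M + 1)) := by gcongr
      _ ≤ 1 := by
          rw [mul_one_div, div_le_one (by positivity)]
          linarith

/-! ### The orbital set -/

theorem dimH_orbitalSet {X : Type*} [MetricSpace X] {N : ℕ} {f : Fin N → X → X} {ρ : Fin N → ℝ}
    (hf : ∀ i, IsContractingSimilarity (f i) (ρ i)) {S : Set (ℕ → Fin N)} (hS : S.Nonempty)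
    (C : Set X) : dimH (orbitalSet f S C) = dimH C := by
  simp only [orbitalSet, wordMap_eq_listMap]
  apply le_antisymm
  · simp only [dimH_iUnion, dimH_listMap_image hf]
    exact iSup_le fun k => iSup_le fun _ => iSup_le fun w => iSup_le fun _ => le_rfl
  -- A single copy of `C`, along a word of length one, already has full dimension.
  · obtain ⟨ω, hω⟩ := hS
    rw [← dimH_listMap_image hf (List.ofFn (initialWord 1 ω)) C]
    refine dimH_mono fun y hy => ?_
    simp only [Set.mem_iUnion]
    exact ⟨1, le_rfl, _, ⟨ω, hω, rfl⟩, hy⟩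

theorem mainTheorem4 (n N : ℕ)
    (f : Fin N → EuclideanSpace ℝ (Fin n) → EuclideanSpace ℝ (Fin n)) (ρ : Fin N → ℝ)
    (hf : ∀ i, IsContractingSimilarity (f i) (ρ i))
    (hosc : OpenSetCondition f)
    (E : Set (EuclideanSpace ℝ (Fin n))) (hE : IsSubSelfSimilar f E)
    (S : Set (ℕ → Fin N)) (hS : IsCompact S) (hshift : ShiftClosed S)
    (hSE : codedSet f S = E)
    (C : Set (EuclideanSpace ℝ (Fin n))) (hC : IsCompact C) :
    (∃! s : ℝ, 0 ≤ s ∧ TauEqOne ρ S s) ∧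
    ∀ s : ℝ, 0 ≤ s → TauEqOne ρ S s →
      dimH (E ∪ orbitalSet f S C) = max (ENNReal.ofReal s) (dimH C) ∧
      dimH (E ∪ (C ∪ orbitalSet f S C)) = max (ENNReal.ofReal s) (dimH C) := by
  subst hSE
  obtain ⟨hEne, hEc, -⟩ := hE
  have hSne : S.Nonempty := by
    obtain ⟨y, hy⟩ := hEne
    obtain ⟨ω, hω, -⟩ := mem_codedSet.1 hy
    exact ⟨ω, hω⟩
  have : Nonempty (Fin N) := ⟨hSne.some 0⟩
  -- The smallest and largest ratios serve as the bounds `a` and `b`.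
  obtain ⟨i, hi⟩ := Finite.exists_min ρ
  obtain ⟨j, hj⟩ := Finite.exists_max ρ
  refine ⟨existsUnique_tauEqOne (hf i).1 hi hj (hf j).1 (hf j).2.1 hSne hshift,
    fun s hs0 hs => ?_⟩
  have hdim : dimH (codedSet f S) = ENNReal.ofReal s :=
    le_antisymm (dimH_codedSet_le hf hj (hf j).1 (hf j).2.1 hSne hshift hEc.isBounded hs0 hs)
      (le_dimH_codedSet hf hosc (hf i).1 hi hj (hf j).1 (hf j).2.1 hSne hshift hEc hs)
  simp [dimH_union, hdim, dimH_orbitalSet hf hSne]
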